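/- Let $q\ge 1$ be an integer and let $\lambda,\mu$ be non-negative integers with $\lambda,\mu<q$ and $\lambda+\mu\ge 1$. Put $\mathcal M=\{-\mu,-\mu+1,\ldots,\lambda\}\setminus\{0\}$ and, for $\mathcal S\subseteq\mathbb Z_q=\mathbb Z/q\mathbb Z$, let $\mathcal M\mathcal S=\{ms \bmod q : m\in\mathcal M,\ s\in\mathcal S\}$. For $r\ge 1$ let $\nu_{\lambda,\mu}(q,r)$ be the maximum of $\#(\mathcal M\mathcal S)$ over all $\mathcal S\subseteq\mathbb Z_q$ with $\#\mathcal S=r$, and let $\omega_{\lambda,\mu}(q)=\min\{r\ge 1 : \nu_{\lambda,\mu}(q,r)=q\}$; that is, $\omega_{\lambda,\mu}(q)$ is the smallest size of a set $\mathcal S\subseteq\mathbb Z_q$ with $\mathcal M\mathcal S=\mathbb Z_q$. Theorem. There is a function $\delta:\mathbb N\to\mathbb R$ with $\delta(q)\to 0$ as $q\to\infty$ such that for every integer $q\ge 1$ and all non-negative integers $\lambda,\mu<q$ with $\lambda+\mu\ge 1$, $$\omega_{\lambda,\mu}(q)\le \frac{q^{1+\delta(q)}}{\max\{\lambda,\mu\}^{1/2}}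 .$$ -/

import Mathlib

namespace CoveringSets

/-- The set of multipliers `{-m, -m + 1, …, l} \ {0}`. -/
noncomputable def multipliers (l m : ℕ) : Finset ℤ :=
  (Finset.Icc (-(m : ℤ)) (l : ℤ)).erase 0

/-- The product set `M S = {a s mod q : a ∈ M, s ∈ S}`, a subset of `ℤ/qℤ`. -/
noncomputable def prodSet (q : ℕ) (M : Finset ℤ) (S : Finset (ZMod q)) : Finset (ZMod q) :=
  Finset.image₂ (fun (a : ℤ) (s : ZMod q) => (a : ZMod q) * s) M S

/-- `nu l m q r` is the largest cardinality of `M S` over all `S ⊆ ℤ/qℤ` with `r` elements,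
where `M = multipliers l m`. The set of cardinalities is bounded by `(l + m) * r`; if there is no
such `S` (that is, `r > q ≥ 1`), the value is `0`. -/
noncomputable def nu (l m q r : ℕ) : ℕ :=
  sSup {k : ℕ | ∃ S : Finset (ZMod q), S.card = r ∧ (prodSet q (multipliers l m) S).card = k}

/-- `omega l m q` is the least `r ≥ 1` with `nu l m q r = q`. -/
noncomputable def omega (l m q : ℕ) : ℕ :=
  sInf {r : ℕ | 1 ≤ r ∧ nu l m q r = q}

/-- `nu l m q r = q` says that some set of `r` residues modulo `q` is a covering set. -/
theorem nu_eq_iff (l m q r : ℕ) [NeZero q] :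
    nu l m q r = q ↔
      ∃ S : Finset (ZMod q), S.card = r ∧ prodSet q (multipliers l m) S = Finset.univ := by
  have hb : ∀ T : Finset (ZMod q), T.card ≤ q := fun T => by
    simpa [ZMod.card] using Finset.card_le_univ T
  have hbdd : BddAbove {k : ℕ | ∃ S : Finset (ZMod q),
      S.card = r ∧ (prodSet q (multipliers l m) S).card = k} := by
    refine ⟨q, ?_⟩
    rintro k ⟨S, -, rfl⟩
    exact hb _
  constructor
  · intro h
    have hne : {k : ℕ | ∃ S : Finset (ZMod q),
        S.card = r ∧ (prodSet q (multipliers l m) S).card = k}.Nonempty := by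
      by_contra hc
      rw [Set.not_nonempty_iff_eq_empty] at hc
      rw [nu, hc, csSup_empty] at h
      exact NeZero.ne q h.symm
    obtain ⟨S, hS, hk⟩ := Nat.sSup_mem hne hbdd
    refine ⟨S, hS, (Finset.card_eq_iff_eq_univ _).1 ?_⟩
    rw [hk, ZMod.card]
    exact h
  · rintro ⟨S, hS, hk⟩
    apply le_antisymm
    · refine csSup_le ⟨_, S, hS, rfl⟩ ?_
      rintro k ⟨T, -, rfl⟩
      exact hb _
    · refine le_csSup hbdd ⟨S, hS, ?_⟩
      rw [hk, Finset.card_univ, ZMod.card]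

/-- The minimum that defines `omega` is attained. -/
theorem omega_spec (l m q : ℕ) [NeZero q] (h : 0 < l + m) :
    1 ≤ omega l m q ∧ nu l m q (omega l m q) = q := by
  refine Nat.sInf_mem (s := {r : ℕ | 1 ≤ r ∧ nu l m q r = q})
    ⟨q, NeZero.one_le, (nu_eq_iff l m q q).2 ⟨Finset.univ, by simp [ZMod.card], ?_⟩⟩
  ext x
  simp only [prodSet, Finset.mem_image₂, Finset.mem_univ, true_and, iff_true]
  by_cases hl : 0 < l
  · exact ⟨1, by simp [multipliers]; omega, x, by simp⟩
  · exact ⟨-1, by simp [multipliers]; omega, -x, by simp⟩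

end CoveringSets

namespace CoveringSets

open Finset Real Asymptotics

/-! Put H = max(λ, μ). The multipliers 1, …, H suffice, up to replacing S by -S. Let A be the primes
up to H not dividing q. If q / gcd(x, q) > H, the points a⁻¹x with a ∈ A are distinct, so x is hit
by at least #A choices of s, and a greedy choice of about (q / #A) log q elements covers all such x.
Every other x is a multiplier times a divisor of q, which costs at most 2√q ≤ 2q / √H further
elements. A crude Chebyshev bound gives #A ≫ √H unless H ≪ (log q)², where ω ≤ q is enough. Hence
ω√H ≪ q(1 + log q), and the logarithm is absorbed into q ^ δ(q). -/

/-- Greedy covering: if every point of `T` lies in at least `a` of the sets `f y`, then after `k`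
steps at most a proportion `(1 - a / #Y) ^ k` of `T` is left uncovered. -/
theorem exists_greedy_cover {X Y : Type*} [DecidableEq X] [DecidableEq Y] [Fintype Y] [Nonempty Y]
    (f : Y → Finset X) (T : Finset X) (a : ℕ) (ha : a ≤ Fintype.card Y)
    (h : ∀ x ∈ T, a ≤ #{y | x ∈ f y}) (k : ℕ) :
    ∃ S : Finset Y, #S ≤ k ∧
      (#(T \ S.biUnion f) : ℝ) ≤ #T * (1 - a / Fintype.card Y) ^ k := by
  have hN : (0 : ℝ) < Fintype.card Y := by exact_mod_cast Fintype.card_pos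
  induction k with
  | zero => exact ⟨∅, by simp, by simp⟩
  | succ k ih =>
    obtain ⟨S, hS, hU⟩ := ih
    set U := T \ S.biUnion f with hUdef
    have hcount : #U * a ≤ ∑ y, #(U ∩ f y) := by
      have hswap : ∑ y, #(U ∩ f y) = ∑ x ∈ U, #{y | x ∈ f y} := by
        simp_rw [← filter_mem_eq_inter]
        exact sum_card_bipartiteAbove_eq_sum_card_bipartiteBelow (s := univ) (t := U)
          (fun y x => x ∈ f y)
      rw [hswap, ← smul_eq_mul]
      exact card_nsmul_le_sum _ _ _ fun x hx => h x (mem_sdiff.1 hx).1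
    -- Some y reaches the average number of still uncovered points.
    obtain ⟨y, -, hy⟩ : ∃ y ∈ (univ : Finset Y),
        (#U * a : ℝ) / Fintype.card Y ≤ #(U ∩ f y) := by
      refine exists_le_of_sum_le univ_nonempty ?_
      rw [sum_const, card_univ, nsmul_eq_mul, mul_div_cancel₀ _ hN.ne']
      exact_mod_cast hcount
    refine ⟨insert y S, (card_insert_le _ _).trans (by omega), ?_⟩
    have hsd : T \ (insert y S).biUnion f = U \ f y := by
      ext x
      simp only [hUdef, biUnion_insert, mem_sdiff, mem_union]
      tauto
    have hcard : (#(U \ f y) : ℝ) = #U - #(U ∩ f y) := by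
      rw [eq_sub_iff_add_eq]
      exact_mod_cast card_sdiff_add_card_inter U (f y)
    have hone : (0 : ℝ) ≤ 1 - a / Fintype.card Y := by
      rw [sub_nonneg, div_le_one hN]
      exact_mod_cast ha
    rw [hsd, hcard, pow_succ]
    calc (#U : ℝ) - #(U ∩ f y) ≤ #U * (1 - a / Fintype.card Y) := by
          rw [mul_sub, mul_one, ← mul_div_assoc]; linarith
      _ ≤ _ := by rw [← mul_assoc]; gcongr

/-- The logarithmic form of the greedy covering bound. -/
theorem exists_cover_card_le {X Y : Type*} [DecidableEq X] [DecidableEq Y] [Fintype Y] [Nonempty Y]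
    (f : Y → Finset X) (T : Finset X) (a : ℕ) (ha0 : 0 < a) (ha : a ≤ Fintype.card Y)
    (h : ∀ x ∈ T, a ≤ #{y | x ∈ f y}) :
    ∃ S : Finset Y, T ⊆ S.biUnion f ∧ (#S : ℝ) ≤ Fintype.card Y / a * log #T + 1 := by
  have hN : (0 : ℝ) < Fintype.card Y := by exact_mod_cast Fintype.card_pos
  have ha0' : (0 : ℝ) < a := by exact_mod_cast ha0
  rcases T.eq_empty_or_nonempty with rfl | hT
  · exact ⟨∅, by simp, by simp⟩
  have hT' : (0 : ℝ) < #T := by exact_mod_cast hT.card_pos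
  have hlog : 0 ≤ log #T := log_natCast_nonneg _
  set z : ℝ := Fintype.card Y / a * log #T with hz
  have hz0 : 0 ≤ z := by positivity
  -- More than z steps leave strictly fewer than one point uncovered, hence none.
  obtain ⟨S, hS, hU⟩ := exists_greedy_cover f T a ha h (⌊z⌋₊ + 1)
  refine ⟨S, ?_, ?_⟩
  · rw [← sdiff_eq_empty_iff_subset, ← card_eq_zero]
    have hone : (0 : ℝ) ≤ 1 - a / Fintype.card Y := by
      rw [sub_nonneg, div_le_one hN]
      exact_mod_cast ha
    have hlt : (#(T \ S.biUnion f) : ℝ) < 1 := by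
      refine hU.trans_lt ?_
      calc (#T : ℝ) * (1 - a / Fintype.card Y) ^ (⌊z⌋₊ + 1)
          ≤ #T * exp (-(a / Fintype.card Y)) ^ (⌊z⌋₊ + 1) := by
            gcongr
            exact one_sub_le_exp_neg _
        _ = #T * exp (-(a / Fintype.card Y * (⌊z⌋₊ + 1 : ℝ))) := by
            rw [← exp_nat_mul]; push_cast; ring_nf
        _ < #T * exp (-(a / Fintype.card Y * z)) := by
            gcongr
            exact Nat.lt_floor_add_one z
        _ = 1 := by
            have : (a : ℝ) / Fintype.card Y * z = log #T := by
              rw [hz]; field_simp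
            rw [this, exp_neg, exp_log hT', mul_inv_cancel₀ hT'.ne']
    have hlt' : #(T \ S.biUnion f) < 1 := by exact_mod_cast hlt
    omega
  · calc (#S : ℝ) ≤ (⌊z⌋₊ + 1 : ℕ) := by exact_mod_cast hS
      _ ≤ z + 1 := by push_cast; gcongr; exact Nat.floor_le hz0

/-! ### Divisor and prime counts -/

theorem card_divisors_le_two_mul_sqrt (n : ℕ) : #n.divisors ≤ 2 * n.sqrt := by
  have hsub : n.divisors ⊆ Icc 1 n.sqrt ∪ (Icc 1 n.sqrt).image (n / ·) := by
    intro d hd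
    obtain ⟨⟨e, rfl⟩, hn⟩ := Nat.mem_divisors.1 hd
    have hd0 : d ≠ 0 := left_ne_zero_of_mul hn
    have he0 : e ≠ 0 := right_ne_zero_of_mul hn
    rw [mem_union, mem_image]
    rcases le_total d e with h | h
    · exact Or.inl (mem_Icc.2 ⟨by omega, Nat.le_sqrt.2 (Nat.mul_le_mul_left d h)⟩)
    · exact Or.inr ⟨e, mem_Icc.2 ⟨by omega, Nat.le_sqrt.2 (Nat.mul_le_mul_right e h)⟩,
        Nat.mul_div_cancel _ (by omega)⟩
  calc #n.divisors ≤ _ := card_le_card hsub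
    _ ≤ _ := card_union_le _ _
    _ ≤ n.sqrt + n.sqrt := by
      gcongr
      · simp
      · exact card_image_le.trans (by simp)
    _ = _ := by ring

/-- A weak form of Chebyshev's lower bound for the prime counting function. -/
theorem sqrt_le_five_mul_primeCounting {n : ℕ} (hn : 16 ≤ n) :
    √(n : ℝ) ≤ 5 * Nat.primeCounting n := by
  have hn' : (16 : ℝ) ≤ n := by exact_mod_cast hn
  have h1 := (Chebyshev.psi_ge n).trans (Chebyshev.psi_le_primeCounting_mul_log n)
  have hs0 : 0 < √(n : ℝ) := sqrt_pos.2 (by linarith)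
  have hsq : √(n : ℝ) * √(n : ℝ) = n := mul_self_sqrt (by linarith)
  have hlogn : log n ≤ 2 * √(n : ℝ) := by
    have := log_le_sub_one_of_pos hs0
    rw [log_sqrt (by linarith)] at this
    linarith
  have h2 := log_two_gt_d9
  have h3 := log_two_lt_d9
  -- Rescaling by 8 makes log t ≤ t - 1 sharp enough; the remaining constant is absorbed by n ≥ 16.
  have hlog8 : log (n + 1) ≤ n / 4 := by
    have := log_le_sub_one_of_pos (show (0 : ℝ) < (n + 1) / 2 ^ 3 by positivity)
    rw [log_div (by positivity) (by positivity), log_pow] at this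
    push_cast at this
    linarith
  have hpi : (0 : ℝ) ≤ Nat.primeCounting n := by positivity
  have h4 : (Nat.primeCounting n : ℝ) * log n ≤ Nat.primeCounting n * (2 * √(n : ℝ)) := by gcongr
  have h5 : √(n : ℝ) * √(n : ℝ) ≤ 5 * Nat.primeCounting n * √(n : ℝ) := by nlinarith
  exact le_of_mul_le_mul_right h5 hs0

theorem card_primeFactors_le_log (n : ℕ) (hn : n ≠ 0) : #n.primeFactors ≤ Nat.log 2 n := by
  refine Nat.le_log_of_pow_le (by norm_num) ?_
  calc 2 ^ #n.primeFactors ≤ ∏ p ∈ n.primeFactors, p :=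
        pow_card_le_prod _ _ _ fun p hp => (Nat.prime_of_mem_primeFactors hp).two_le
    _ ≤ n := Nat.le_of_dvd (by omega) (Nat.prod_primeFactors_dvd n)

/-! ### Covering residues modulo q -/

/-- A covering set for the multipliers `1, …, max l m` bounds `omega l m q`. -/
theorem omega_le_card {l m q : ℕ} [NeZero q] (S : Finset (ZMod q))
    (hS : ∀ x : ZMod q, ∃ a : ℕ, 1 ≤ a ∧ a ≤ max l m ∧ ∃ s ∈ S, (a : ZMod q) * s = x) :
    omega l m q ≤ #S := by
  have key : ∀ S' : Finset (ZMod q),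
      prodSet q (multipliers l m) S' = Finset.univ → omega l m q ≤ #S' := by
    intro S' h
    refine Nat.sInf_le ⟨?_, (nu_eq_iff l m q _).2 ⟨S', rfl, h⟩⟩
    rw [Nat.one_le_iff_ne_zero, Ne, card_eq_zero]
    rintro rfl
    simp only [prodSet, image₂_empty_right] at h
    exact univ_nonempty.ne_empty h.symm
  rcases le_total m l with hml | hml
  · refine key S (eq_univ_of_forall fun x => ?_)
    obtain ⟨a, ha1, ha, s, hs, rfl⟩ := hS x
    exact mem_image₂.2 ⟨a, by simp [multipliers]; omega, s, hs, by simp⟩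
  · refine (key (S.image (- ·)) (eq_univ_of_forall fun x => ?_)).trans card_image_le
    obtain ⟨a, ha1, ha, s, hs, rfl⟩ := hS x
    exact mem_image₂.2 ⟨-a, by simp [multipliers]; omega, -s, mem_image_of_mem _ hs, by simp⟩

/-- Residues `x` with `q / gcd (x, q) ≤ h` are small multiples of divisors of `q`. -/
theorem exists_mul_divisor_eq {q h : ℕ} [NeZero q] (x : ZMod q) (hx : q / x.val.gcd q ≤ h)
    (hh : 1 ≤ h) : ∃ a : ℕ, 1 ≤ a ∧ a ≤ h ∧ ∃ d ∈ q.divisors, (a : ZMod q) * (d : ZMod q) = x := by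
  have hq := NeZero.ne q
  by_cases h0 : x = 0
  · exact ⟨1, le_rfl, hh, q, by simp [hq], by simp [h0]⟩
  have hv : 0 < x.val := Nat.pos_of_ne_zero (by rwa [Ne, ZMod.val_eq_zero])
  have hg : 0 < x.val.gcd q := Nat.gcd_pos_of_pos_left _ hv
  refine ⟨x.val / x.val.gcd q, Nat.div_pos (Nat.gcd_le_left _ hv) hg,
    (Nat.div_le_div_right (ZMod.val_lt x).le).trans hx, x.val.gcd q,
    Nat.mem_divisors.2 ⟨Nat.gcd_dvd_right _ _, hq⟩, ?_⟩
  rw [← Nat.cast_mul, Nat.div_mul_cancel (Nat.gcd_dvd_left _ _), ZMod.natCast_zmod_val]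

/-- If `h < q / gcd (x, q)`, distinct units `a ≤ h` give distinct solutions `y` of `a y = x`. -/
theorem card_le_card_solutions {q h : ℕ} [NeZero q] (A : Finset ℕ)
    (hA : ∀ a ∈ A, a ≤ h ∧ a.Coprime q) (x : ZMod q) (hx : h < q / x.val.gcd q) :
    #A ≤ #{y : ZMod q | x ∈ A.image fun a : ℕ => (a : ZMod q) * y} := by
  refine card_le_card_of_injOn (fun a : ℕ => (a : ZMod q)⁻¹ * x) ?_ ?_
  · intro a ha
    have hu := ZMod.coe_mul_inv_eq_one a (hA a ha).2
    simp only [coe_filter, mem_univ, true_and, Set.mem_ofPred_eq, mem_image]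
    exact ⟨a, ha, by rw [← mul_assoc, hu, one_mul]⟩
  · intro a ha b hb hab
    have hua := ZMod.coe_mul_inv_eq_one a (hA a ha).2
    have hub := ZMod.coe_mul_inv_eq_one b (hA b hb).2
    have hmul : (a : ZMod q) * x = b * x := by
      simp only at hab
      calc (a : ZMod q) * x = a * (b * (b : ZMod q)⁻¹) * x := by rw [hub, mul_one]
        _ = a * b * ((b : ZMod q)⁻¹ * x) := by ring
        _ = a * b * ((a : ZMod q)⁻¹ * x) := by rw [hab]
        _ = b * (a * (a : ZMod q)⁻¹) * x := by ring
        _ = b * x := by rw [hua, mul_one]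
    have hmod : a * x.val ≡ b * x.val [MOD q] := by
      rw [← ZMod.natCast_eq_natCast_iff]
      push_cast
      rwa [ZMod.natCast_zmod_val]
    -- Cancelling x leaves a congruence modulo q / gcd(x, q), which exceeds both a and b.
    have hmod' := Nat.ModEq.cancel_right_div_gcd (NeZero.pos q) hmod
    rw [Nat.gcd_comm] at hmod'
    exact hmod'.eq_of_lt_of_lt ((hA a ha).1.trans_lt hx) ((hA b hb).1.trans_lt hx)

/-- Divisors of `q` together with a greedily chosen set form a covering set. -/
theorem omega_le_of_coprime_multipliers {l m q : ℕ} [NeZero q] (hm : max l m < q)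
    (A : Finset ℕ) (hA : ∀ a ∈ A, 1 ≤ a ∧ a ≤ max l m ∧ a.Coprime q) (hA0 : A.Nonempty) :
    (omega l m q : ℝ) ≤ q / #A * log q + 1 + 2 * √(q : ℝ) := by
  set h := max l m
  have hh : 1 ≤ h := by
    obtain ⟨a, ha⟩ := hA0
    have := hA a ha
    omega
  have hAq : #A ≤ q := by
    have : A ⊆ Icc 1 h := fun a ha => mem_Icc.2 ⟨(hA a ha).1, (hA a ha).2.1⟩
    have := card_le_card this
    simp only [Nat.card_Icc] at this
    omega
  set T : Finset (ZMod q) := {x | h < q / x.val.gcd q}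
  obtain ⟨S, hS, hScard⟩ := exists_cover_card_le
    (fun y : ZMod q => A.image fun a : ℕ => (a : ZMod q) * y) T #A hA0.card_pos
    (by rwa [ZMod.card])
    (fun x hx => card_le_card_solutions A (fun a ha => (hA a ha).2) x (mem_filter.1 hx).2)
  rw [ZMod.card] at hScard
  have hcover : omega l m q ≤ #(S ∪ q.divisors.image (Nat.cast : ℕ → ZMod q)) := by
    refine omega_le_card _ fun x => ?_
    by_cases hx : h < q / x.val.gcd q
    · obtain ⟨y, hy, hxy⟩ := mem_biUnion.1 (hS (mem_filter.2 ⟨mem_univ x, hx⟩))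
      obtain ⟨a, ha, rfl⟩ := mem_image.1 hxy
      exact ⟨a, (hA a ha).1, (hA a ha).2.1, y, mem_union_left _ hy, rfl⟩
    · obtain ⟨a, ha1, ha, d, hd, hx⟩ := exists_mul_divisor_eq x (not_lt.1 hx) hh
      exact ⟨a, ha1, ha, d, mem_union_right _ (mem_image_of_mem _ hd), hx⟩
  have hdiv : #(q.divisors.image (Nat.cast : ℕ → ZMod q)) ≤ 2 * q.sqrt :=
    card_image_le.trans (card_divisors_le_two_mul_sqrt q)
  have hlogT : log #T ≤ log q := by
    rcases T.eq_empty_or_nonempty with hT | hT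
    · simpa [hT] using log_natCast_nonneg q
    · refine log_le_log (by exact_mod_cast hT.card_pos) ?_
      exact_mod_cast (card_le_univ T).trans (by rw [ZMod.card])
  have hdiv' : (#(q.divisors.image (Nat.cast : ℕ → ZMod q)) : ℝ) ≤ 2 * √(q : ℝ) :=
    calc _ ≤ 2 * (q.sqrt : ℝ) := by exact_mod_cast hdiv
      _ ≤ _ := by gcongr; exact nat_sqrt_le_real_sqrt
  calc (omega l m q : ℝ)
      ≤ #S + #(q.divisors.image (Nat.cast : ℕ → ZMod q)) := by
        exact_mod_cast hcover.trans (card_union_le _ _)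
    _ ≤ q / #A * log #T + 1 + 2 * √(q : ℝ) := add_le_add hScard hdiv'
    _ ≤ _ := by gcongr

/-! ### The explicit bound and its exponent -/

theorem omega_le_self {l m q : ℕ} [NeZero q] (h : 0 < l + m) : omega l m q ≤ q := by
  refine (omega_le_card univ fun x => ⟨1, le_rfl, by omega, x, mem_univ x, by simp⟩).trans ?_
  rw [card_univ, ZMod.card]

theorem omega_mul_sqrt_le {l m q : ℕ} (hl : l < q) (hm : m < q) (h : 0 < l + m) :
    (omega l m q : ℝ) * √((max l m : ℕ) : ℝ) ≤ q * (4 + 20 * log q) := by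
  have : NeZero q := ⟨by omega⟩
  have hmax : max l m < q := max_lt hl hm
  have hmax0 : 0 < max l m := by omega
  generalize hh : max l m = H at *
  have hq2 : 2 ≤ q := by omega
  have hq2' : (2 : ℝ) ≤ q := by exact_mod_cast hq2
  have hlogq : 0 ≤ log q := log_natCast_nonneg q
  set L := Nat.log 2 q
  have hL1 : 1 ≤ L := Nat.log_pos (by norm_num) hq2
  have hLlog : (L : ℝ) ≤ 2 * log q := by
    have h1 : (2 : ℝ) ^ L ≤ q := by exact_mod_cast Nat.pow_log_le_self 2 (by omega : q ≠ 0)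
    have h2 := log_le_log (by positivity) h1
    rw [log_pow] at h2
    have h3 := log_two_gt_d9
    have h4 : (0 : ℝ) ≤ L := by positivity
    nlinarith
  have hs0 : 0 < √(H : ℝ) := sqrt_pos.2 (by exact_mod_cast hmax0)
  -- Below the threshold √H ≤ 10L ≤ 20 log q, so the trivial bound suffices. Above it L ≤ √H / 10,
  -- so discarding the at most L primes dividing q from at least √H / 5 primes leaves at least √H /
  -- 10.
  by_cases hcase : H ≤ 100 * L ^ 2
  · have h1 : √(H : ℝ) ≤ 10 * L := by
      rw [sqrt_le_left (by positivity)]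
      have : (H : ℝ) ≤ 100 * L ^ 2 := by exact_mod_cast hcase
      linarith
    have h2 : (omega l m q : ℝ) ≤ q := by exact_mod_cast omega_le_self h
    calc _ ≤ (q : ℝ) * (10 * L) := by gcongr
      _ ≤ _ := by gcongr; linarith
  · push Not at hcase
    have hH16 : 16 ≤ H := by nlinarith
    have h1 : 10 * (L : ℝ) ≤ √(H : ℝ) := by
      refine le_sqrt_of_sq_le ?_
      have : (100 * L ^ 2 : ℝ) ≤ H := by exact_mod_cast hcase.le
      linarith
    set A := Nat.primesLE H \ q.primeFactors with hAdef
    have hA : ∀ a ∈ A, 1 ≤ a ∧ a ≤ H ∧ a.Coprime q := by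
      intro a ha
      rw [hAdef, mem_sdiff, Nat.mem_primesLE] at ha
      refine ⟨ha.1.2.one_le, ha.1.1, (Nat.Prime.coprime_iff_not_dvd ha.1.2).2 fun hd => ha.2 ?_⟩
      exact Nat.mem_primeFactors.2 ⟨ha.1.2, hd, by omega⟩
    have hAcard : √(H : ℝ) ≤ 10 * #A := by
      have h2 := sqrt_le_five_mul_primeCounting hH16
      have h3 : Nat.primeCounting H ≤ #A + L := by
        have := card_primeFactors_le_log q (by omega)
        have := le_card_sdiff q.primeFactors (Nat.primesLE H)
        rw [Nat.primesLE_card_eq_primeCounting, ← hAdef] at this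
        omega
      have h3' : (Nat.primeCounting H : ℝ) ≤ #A + L := by exact_mod_cast h3
      linarith
    have hA0 : (0 : ℝ) < #A := by linarith
    have hbound := omega_le_of_coprime_multipliers (hh ▸ hmax) A (hh ▸ hA)
      (card_pos.1 (by exact_mod_cast hA0))
    have hHq : √(H : ℝ) ≤ √(q : ℝ) := sqrt_le_sqrt (by exact_mod_cast hmax.le)
    have hqq : √(q : ℝ) * √(q : ℝ) = q := mul_self_sqrt (by positivity)
    have hqs : √(q : ℝ) ≤ q := by
      rw [sqrt_le_left (by positivity)]
      nlinarith
    have e1 : (q : ℝ) / #A * log q * √(H : ℝ) ≤ q * (10 * log q) := by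
      calc (q : ℝ) / #A * log q * √(H : ℝ) ≤ q / #A * log q * (10 * #A) := by gcongr
        _ = _ := by field_simp
    have e2 : 2 * √(q : ℝ) * √(H : ℝ) ≤ 2 * q := by
      have := mul_le_mul_of_nonneg_left hHq (sqrt_nonneg (q : ℝ))
      linarith
    have e3 : 0 ≤ (q : ℝ) * log q := by positivity
    calc _ ≤ ((q : ℝ) / #A * log q + 1 + 2 * √(q : ℝ)) * √(H : ℝ) := by gcongr
      _ ≤ _ := by nlinarith

theorem tendsto_log_affine_log_div_log :
    Filter.Tendsto (fun q : ℕ => log (4 + 20 * log q) / log q) Filter.atTop (nhds 0) := by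
  have h1 : Filter.Tendsto (fun y : ℝ => log (4 + 20 * y) / y) Filter.atTop (nhds 0) := by
    have haff : Filter.Tendsto (fun y : ℝ => 4 + 20 * y) Filter.atTop Filter.atTop :=
      Filter.tendsto_atTop_add_const_left _ _
        (Filter.tendsto_id.const_mul_atTop (by norm_num : (0 : ℝ) < 20))
    have hO : (id ∘ fun y : ℝ => 4 + 20 * y) =O[Filter.atTop] fun y : ℝ => y := by
      refine IsBigO.of_bound 24 ?_
      filter_upwards [Filter.eventually_ge_atTop 1] with y hy
      simp only [Function.comp, id, norm_eq_abs]
      rw [abs_of_nonneg (by linarith), abs_of_nonneg (by linarith)]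
      linarith
    exact ((isLittleO_log_id_atTop.comp_tendsto haff).trans_isBigO hO).tendsto_div_nhds_zero
  exact h1.comp (tendsto_log_atTop.comp tendsto_natCast_atTop_atTop)

end CoveringSets

theorem mainTheorem3 :
    ∃ δ : ℕ → ℝ, Filter.Tendsto δ Filter.atTop (nhds 0) ∧
      ∀ q l m : ℕ, 1 ≤ q → l < q → m < q → 0 < l + m →
        (CoveringSets.omega l m q : ℝ) ≤
          (q : ℝ) ^ (1 + δ q) / ((max l m : ℕ) : ℝ) ^ (1 / 2 : ℝ) := by
  -- This δ is chosen so that q ^ δ(q) = 4 + 20 log q for q ≥ 2.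
  refine ⟨_, CoveringSets.tendsto_log_affine_log_div_log, fun q l m _ hl hm h => ?_⟩
  have hq2 : (2 : ℝ) ≤ q := by exact_mod_cast (by omega : 2 ≤ q)
  have hlog : 0 < Real.log q := Real.log_pos (by linarith)
  have hmax : (0 : ℝ) < (max l m : ℕ) := by exact_mod_cast (by omega : 0 < max l m)
  rw [← Real.sqrt_eq_rpow, le_div_iff₀ (Real.sqrt_pos.2 hmax), Real.rpow_add (by linarith),
    Real.rpow_one, Real.rpow_def_of_pos (by linarith) (_ / _), mul_div_cancel₀ _ hlog.ne',
    Real.exp_log (by positivity)]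
  exact CoveringSets.omega_mul_sqrt_le hl hm h
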